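/- For an infinite cardinal $\lambda$, say that SCH holds at $\lambda$ if $\lambda^{\operatorname{cf}(\lambda)} = 2^{\operatorname{cf}(\lambda)} + \lambda^+$. Let ESCH (the eventual singular cardinal hypothesis) be the statement that there is a cardinal $\theta_0$ such that SCH holds at every infinite cardinal $\lambda \ge \theta_0$. For a regular cardinal $\theta$, an object $M$ of a category $\mathcal K$ is $\theta$-presentable if $\operatorname{Hom}_{\mathcal K}(M,-)$ preserves $\theta$-directed colimits, and the presentability rank of $M$ is the least regular cardinal $\theta$ such that $M$ is $\theta$-presentable. The (locally small) category $\mathcal K$ is $\theta$-accessible if it has $\theta$-directed colimits, has only a set of $\theta$-presentable objects up to isomorphism, and every object is a $\theta$-directed colimit of $\theta$-presentable objects. A category is large if it has a proper class of pairwise non-isomorphic objects. **Corollary.** Assume ESCH. Let $\mathcal K$ be a large category all of whose morphisms are monomorphisms. Then there is a cardinal $\theta_0$ such that for every successor cardinal $\theta \ge \theta_0$, if $\mathcal K$ is $\theta$-accessible, then $\mathcal K$ has an object of presentability rank $\theta$. In other words, the successor cardinals in the accessibility spectrum of $\mathcal K$ (the class of regular $\theta$ such that $\mathcal K$ is $\theta$-accessible)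 are eventually contained in its existence spectrum (the class of regular $\theta$ such that $\mathcal K$ has an object of presentability rank $\theta$). -/

import Mathlib

open CategoryTheory Cardinal

universe w v u

/-- `SCH` holds at the cardinal `c`: `c ^ cf c = 2 ^ cf c + c⁺`. -/
def SCHAt (c : Cardinal.{w}) : Prop :=
  c ^ c.ord.cof = 2 ^ c.ord.cof + Order.succ c

/-- `SCH` holds above `c`: it holds at every infinite cardinal `θ ≥ c`. -/
def SCHAbove (c : Cardinal.{w}) : Prop :=
  ∀ θ : Cardinal.{w}, ℵ₀ ≤ θ → c ≤ θ → SCHAt θ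

/-- The eventual singular cardinal hypothesis, for the cardinals of the universe `w`. -/
def ESCH : Prop :=
  ∃ θ₀ : Cardinal.{w}, SCHAbove θ₀

/-- A category is large if its isomorphism classes of objects form a proper class,
where "set" means `w`-small. -/
def IsLargeCategory (K : Type u) [Category.{v} K] : Prop :=
  ¬ Small.{w} (Quotient (isIsomorphicSetoid K))

/-- The presentability rank of `M` is `θ`: `θ` is the least regular cardinal such that
`M` is `θ`-presentable. -/
def HasPresentabilityRank {K : Type u} [Category.{v} K] (M : K) (θ : Cardinal.{w}) : Prop :=
  IsLeast {κ : Cardinal.{w} | ∃ _ : Fact κ.IsRegular, IsCardinalPresentable M κ} θ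

/-- The class of regular cardinals `θ` such that `K` is `θ`-accessible. -/
def accessibilitySpectrum (K : Type u) [Category.{v} K] : Set Cardinal.{w} :=
  {θ | ∃ _ : Fact θ.IsRegular, IsCardinalAccessibleCategory K θ}

/-- The class of regular cardinals `θ` such that `K` has an object of presentability rank `θ`. -/
def existenceSpectrum (K : Type u) [Category.{v} K] : Set Cardinal.{w} :=
  {θ | ∃ M : K, HasPresentabilityRank M θ}

/-! Let `K` be accessible at some `κ` and let `θ = μ⁺` be large. By largeness some `N` is not
`μ⁺`-presentable; it is a `μ⁺`-directed colimit of `μ⁺`-presentable objects.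

If `μ` is regular, that diagram never stabilizes, so it contains a chain of length `μ` of
non-isomorphisms. The colimit of the chain is `μ⁺`-presentable. Were it `μ`-presentable, its
identity would factor through a stage, whose coprojection, a split epimorphism and a monomorphism,
would be invertible (`exists_isCardinalPresentable_succ_not_isCardinalPresentable`).

If `μ` is singular, measure objects by the number of morphisms from a small generator. As `N` has
size above `μ`, some `μ⁺`-presentable stage `M` has size at least `μ` (`exists_not_hasCardinalLT`).
If `M` were `l`-presentable with `l < μ`, SCH would give `χ ≥ l` with `χ ^ κ = χ` and `χ⁺ ≤ μ`, and
then `M` would have size at most `χ` (`hasCardinalLT_homsFrom`). -/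

open Limits

/-! ### Cardinal exponentiation under SCH. -/

section CardinalArithmetic

lemma mk_Iic_ord_toType_lt {κ : Cardinal.{w}} (hκ : ℵ₀ ≤ κ) (a : κ.ord.ToType) :
    #(Set.Iic a) < κ := by
  have h : #(Set.Iio a) < κ := by simpa using mk_Iio_lt a
  rw [← Set.Iio_insert]
  refine (mk_insert_le).trans_lt (add_lt_of_lt hκ h (one_lt_aleph0.trans_le hκ))

/-- A function from a set of size `< cf κ` to `κ` is bounded, hence `κ ^ l ≤ κ` as soon as
`c ^ l ≤ κ` for all `c < κ`. -/
lemma power_le_of_lt_cof {κ l : Cardinal.{w}} (hκ : ℵ₀ ≤ κ) (hl : l < κ.ord.cof)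
    (h : ∀ c < κ, c ^ l ≤ κ) : κ ^ l ≤ κ := by
  let φ (x : Σ a : κ.ord.ToType, l.out → Set.Iic a) : l.out → κ.ord.ToType :=
    fun t ↦ (x.2 t).1
  have hφ : Function.Surjective φ := fun f ↦ by
    have hf : ¬ IsCofinal (Set.range f) := fun hf ↦ by
      refine hl.not_ge ?_
      rw [← Ordinal.cof_toType]
      exact (Order.cof_le hf).trans (mk_range_le.trans (by simp))
    simp only [IsCofinal, not_forall, not_exists, not_and, not_le] at hf
    obtain ⟨a, ha⟩ := hf
    exact ⟨⟨a, fun t ↦ ⟨f t, (ha _ ⟨t, rfl⟩).le⟩⟩, rfl⟩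
  have := mk_le_of_surjective hφ
  calc κ ^ l = #(l.out → κ.ord.ToType) := by simp
    _ ≤ #(Σ a : κ.ord.ToType, l.out → Set.Iic a) := this
    _ = sum fun a : κ.ord.ToType ↦ #(Set.Iic a) ^ l := by simp [mk_sigma]
    _ ≤ sum fun _ : κ.ord.ToType ↦ κ := sum_le_sum _ _ fun a ↦ h _ (mk_Iic_ord_toType_lt hκ a)
    _ = κ := by simp [mul_eq_self hκ]

/-- If `c ^ l ≤ κ` for all `c < κ`, then `κ ^ l ≤ κ ^ cf κ`. -/
lemma power_le_power_cof {κ l : Cardinal.{w}} (hκ : ℵ₀ ≤ κ)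
    (h : ∀ c < κ, c ^ l ≤ κ) : κ ^ l ≤ κ ^ κ.ord.cof := by
  obtain ⟨S, hS, hS'⟩ := Order.exists_cof_eq κ.ord.ToType
  -- Truncating `f` at every point of a cofinal set loses nothing: some `s` lies above any two given
  -- values.
  let φ (f : l.out → κ.ord.ToType) (s : S) (t : l.out) : Set.Iic s.1 :=
    ⟨min (f t) s, Set.mem_Iic.2 (min_le_right _ _)⟩
  have hφ : Function.Injective φ := fun f g hfg ↦ by
    ext t
    obtain ⟨s, hs, hs'⟩ := hS (max (f t) (g t))
    have := congr_arg Subtype.val (congr_fun (congr_fun hfg ⟨s, hs⟩) t)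
    simpa [φ, min_eq_left ((le_max_left _ _).trans hs'),
      min_eq_left ((le_max_right _ _).trans hs')] using this
  calc κ ^ l = #(l.out → κ.ord.ToType) := by simp
    _ ≤ #((s : S) → l.out → Set.Iic s.1) := mk_le_of_injective hφ
    _ = Cardinal.prod fun s : S ↦ #(Set.Iic s.1) ^ l := by simp [mk_pi]
    _ ≤ Cardinal.prod fun _ : S ↦ κ := prod_le_prod _ _ fun a ↦ h _ (mk_Iic_ord_toType_lt hκ a.1)
    _ = κ ^ κ.ord.cof := by simp [hS', Ordinal.cof_toType]

/-- Under `SCH` above `b`, if `b ^ l ≤ b` and `2 ^ l ≤ b`, then `κ ^ l ≤ κ⁺` for all `κ ≥ b`. -/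
lemma SCHAbove.power_le_succ {b l : Cardinal.{w}} (hb : SCHAbove b) (h₀ : ℵ₀ ≤ b)
    (hbl : b ^ l ≤ b) (h2 : 2 ^ l ≤ b) (κ : Cardinal.{w}) (hκ : b ≤ κ) :
    κ ^ l ≤ Order.succ κ := by
  induction κ using WellFoundedLT.induction with
  | ind κ ih =>
  have h₁ : ℵ₀ ≤ κ := h₀.trans hκ
  have h (c : Cardinal.{w}) (hc : c < κ) : c ^ l ≤ κ := by
    rcases le_total c b with hcb | hcb
    · exact (power_le_power_right hcb).trans (hbl.trans hκ)
    · exact (ih c hc hcb).trans (Order.succ_le_of_lt hc)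
  rcases lt_or_ge l κ.ord.cof with hl | hl
  · exact (power_le_of_lt_cof h₁ hl h).trans (Order.le_succ κ)
  · refine (power_le_power_cof h₁ h).trans ?_
    rw [hb κ h₁ hκ]
    -- Here `cf κ ≤ l`, so the term `2 ^ cf κ` of SCH is at most `2 ^ l ≤ b ≤ κ`.
    refine add_le_of_le (h₁.trans (Order.le_succ κ)) ?_ le_rfl
    exact (power_le_power_left two_ne_zero hl).trans (h2.trans (hκ.trans (Order.le_succ κ)))

end CardinalArithmetic

/-! ### Counting small subsets. -/

section Cofinal

open CardinalDirectedPoset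

/-- If `χ ^ κ ≤ χ`, then a set of cardinality `< χ⁺` has fewer than `χ⁺` subsets of
cardinality `< κ`. -/
lemma hasCardinalLT_setCardinalLT {κ χ : Cardinal.{w}} (hχ : ℵ₀ ≤ χ)
    (h : χ ^ κ ≤ χ) (X : Type w) (hX : HasCardinalLT X (Order.succ χ)) :
    HasCardinalLT (SetCardinalLT κ X) (Order.succ χ) := by
  rw [hasCardinalLT_iff_cardinal_mk_lt, Order.lt_succ_iff] at hX ⊢
  have : #(SetCardinalLT κ X) ≤ #{t : Set X // #t ≤ κ} :=
    mk_subtype_mono fun t ht ↦ ((hasCardinalLT_iff_cardinal_mk_lt _ _).1 ht).le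
  exact this.trans ((mk_bounded_set_le X κ).trans
    ((power_le_power_right (max_le hX hχ)).trans h))

end Cofinal

/-! ### Size of an object relative to a generator. -/

section Generator

variable {C : Type u} [Category.{v} C]

/-- The type of morphisms from an object satisfying `P` to `X`: a measure of the size of `X`
when `P` is a small generator. -/
abbrev HomsFrom (P : ObjectProperty C) (X : C) : Type (max u v) :=
  Σ A : Subtype P, A.1 ⟶ X

namespace CategoryTheory.ObjectProperty.IsCardinalFilteredGenerator

variable {κ : Cardinal.{w}} [Fact κ.IsRegular] {P : ObjectProperty C}

/-- The filtered criterion for finality amounts to the two halves of presentability: morphisms from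
objects of `P` factor through a stage, and two factorizations agree at a later stage. -/
lemma final_toCostructuredArrow (hP : P ≤ isCardinalPresentable C κ)
    {J : Type w} [SmallCategory J] [IsCardinalFiltered J κ] {X : C} (p : P.ColimitOfShape J X) :
    p.toCostructuredArrow.Final := by
  have := isFiltered_of_isCardinalFiltered J κ
  rw [Functor.final_iff_of_isFiltered]
  refine ⟨fun f ↦ ?_, fun {f j} g₁ g₂ ↦ ?_⟩
  · have : IsCardinalPresentable (P.ι.obj f.left) κ := hP _ f.left.property
    obtain ⟨j, g, hg⟩ := IsCardinalPresentable.exists_hom_of_isColimit κ p.isColimit f.hom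
    exact ⟨j, ⟨CostructuredArrow.homMk (ObjectProperty.homMk g)⟩⟩
  · have : IsCardinalPresentable f.left.obj κ := hP _ f.left.property
    obtain ⟨k, a, h⟩ := IsCardinalPresentable.exists_eq_of_isColimit' κ p.isColimit
      g₁.left.hom g₂.left.hom ((CostructuredArrow.w g₁).trans (CostructuredArrow.w g₂).symm)
    exact ⟨k, a, by cat_disch⟩

lemma isDense (h : P.IsCardinalFilteredGenerator κ) : P.ι.IsDense where
  isDenseAt X := by
    obtain ⟨J, _, _, ⟨p⟩⟩ := h.exists_colimitsOfShape X
    have := final_toCostructuredArrow h.le_isCardinalPresentable p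
    exact ⟨(Functor.Final.isColimitWhiskerEquiv (F := p.toCostructuredArrow) _).1
      (IsColimit.ofIsoColimit p.isColimit (Cocone.ext (Iso.refl _) fun j ↦
        (Category.comp_id _).trans (Category.id_comp _).symm))⟩

/-- An object `X` is `θ`-presentable if it receives fewer than `θ` morphisms from the objects
of a generator. -/
lemma isCardinalPresentable_of_hasCardinalLT [LocallySmall.{w} C]
    (h : P.IsCardinalFilteredGenerator κ)
    {θ : Cardinal.{w}} [Fact θ.IsRegular] (hκθ : κ ≤ θ)
    (hPθ : ∀ A B : Subtype P, HasCardinalLT (A.1 ⟶ B.1) θ)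
    {X : C} (hX : HasCardinalLT (HomsFrom P X) θ) : IsCardinalPresentable X θ := by
  have := h.isDense
  -- `X` is the colimit of its canonical diagram, so it suffices that this diagram has fewer than
  -- `θ` arrows.
  have hobj : HasCardinalLT (CostructuredArrow P.ι X) θ :=
    hX.of_injective (fun f ↦ ⟨⟨f.left.obj, f.left.property⟩, f.hom⟩) (fun f g hfg ↦ by
      obtain ⟨⟨_, _⟩, ⟨⟨⟩⟩, _⟩ := f
      obtain ⟨⟨_, _⟩, ⟨⟨⟩⟩, _⟩ := g
      cases hfg
      rfl)
  have harr : HasCardinalLT (Arrow (CostructuredArrow P.ι X)) θ := by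
    have (f g : CostructuredArrow P.ι X) : HasCardinalLT (f ⟶ g) θ :=
      (hPθ ⟨_, f.left.property⟩ ⟨_, g.left.property⟩).of_injective
        (fun a ↦ a.left.hom) (fun a b hab ↦ by ext; exact hab)
    refine (hasCardinalLT_sigma (fun f ↦ Σ g : CostructuredArrow P.ι X, (f ⟶ g)) θ hobj
      (fun f ↦ hasCardinalLT_sigma _ θ hobj (this f))).of_injective
      (fun a ↦ ⟨a.left, a.right, a.hom⟩) (fun a b hab ↦ by
        obtain ⟨_, _, _⟩ := a
        obtain ⟨_, _, _⟩ := b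
        cases hab
        rfl)
  have := harr.small
  have := small_of_small_arrow.{w} (CostructuredArrow P.ι X)
  have := locallySmall_of_small_arrow.{w} (CostructuredArrow P.ι X)
  have := essentiallySmall_of_small_of_locallySmall.{w} (CostructuredArrow P.ι X)
  have : HasLimitsOfShape (CostructuredArrow P.ι X)ᵒᵖ (Type w) :=
    hasLimitsOfShape_of_equivalence (equivSmallModel.{w} (CostructuredArrow P.ι X)ᵒᵖ).symm
  have (f : CostructuredArrow P.ι X) :
      IsCardinalPresentable ((CostructuredArrow.proj P.ι X ⋙ P.ι).obj f) θ := by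
    have : IsCardinalPresentable f.left.obj κ := h.le_isCardinalPresentable _ f.left.property
    exact isCardinalPresentable_of_le f.left.obj hκθ
  exact isCardinalPresentable_of_isColimit _ (P.ι.denseAt X) θ harr

/-- If `X` is the colimit of a `μ⁺`-filtered diagram and receives more than `μ` morphisms
from the objects of a generator, then some object of the diagram receives at least `μ` of
them. -/
lemma exists_not_hasCardinalLT (h : P.IsCardinalFilteredGenerator κ)
    {μ : Cardinal.{w}} [Fact (Order.succ μ).IsRegular] (hκμ : κ ≤ Order.succ μ)
    {J : Type w} [SmallCategory J] [IsCardinalFiltered J (Order.succ μ)]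
    {D : J ⥤ C} {c : Cocone D} (hc : IsColimit c)
    (hX : ¬ HasCardinalLT (HomsFrom P c.pt) (Order.succ μ)) :
    ∃ j, ¬ HasCardinalLT (HomsFrom P (D.obj j)) μ := by
  -- Only `μ` of the morphisms are kept, so that the stages they factor through have a common upper
  -- bound.
  obtain ⟨φ⟩ : Nonempty (ULift.{max u v} μ.out ↪ ULift.{w} (HomsFrom P c.pt)) := by
    rw [HasCardinalLT, lift_succ, Order.lt_succ_iff, not_le] at hX
    rw [← Cardinal.le_def, mk_uLift, mk_uLift, mk_out]
    exact hX.le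
  let f (t : μ.out) : HomsFrom P c.pt := (φ ⟨t⟩).down
  have hf : Function.Injective f := fun t t' htt' ↦
    ULift.up_injective (φ.injective (ULift.down_injective htt'))
  have (t : μ.out) : ∃ (j : J) (g : (f t).1.1 ⟶ D.obj j), g ≫ c.ι.app j = (f t).2 := by
    have : IsCardinalPresentable (f t).1.1 κ := h.le_isCardinalPresentable _ (f t).1.2
    have : IsCardinalPresentable (f t).1.1 (Order.succ μ) := isCardinalPresentable_of_le _ hκμ
    exact IsCardinalPresentable.exists_hom_of_isColimit (Order.succ μ) hc _
  choose j g hg using this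
  have hμ : HasCardinalLT μ.out (Order.succ μ) := by
    simp [hasCardinalLT_iff_cardinal_mk_lt]
  let ψ (t : μ.out) : HomsFrom P (D.obj (IsCardinalFiltered.max j hμ)) :=
    ⟨(f t).1, g t ≫ D.map (IsCardinalFiltered.toMax j hμ t)⟩
  have hψ (t : μ.out) : (⟨(ψ t).1, (ψ t).2 ≫ c.ι.app _⟩ : HomsFrom P c.pt) = f t := by
    simp [ψ, hg]
  refine ⟨IsCardinalFiltered.max j hμ, fun hlt ↦ ?_⟩
  have := hlt.of_injective ψ (fun t t' htt' ↦ hf (by rw [← hψ, ← hψ, htt']))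
  simp [hasCardinalLT_iff_cardinal_mk_lt] at this

end CategoryTheory.ObjectProperty.IsCardinalFilteredGenerator

end Generator

/-! ### Decomposing a directed colimit along small directed subsets. -/

section DirectedSubsets

variable {C : Type u} [Category.{v} C]
variable {α : Type w} [PartialOrder α]

/-- The `κ₁`-directed subsets of cardinality `< κ₂` of a partially ordered type. -/
abbrev DirectedSubset (κ₁ κ₂ : Cardinal.{w}) [Fact κ₁.IsRegular] (α : Type w)
    [PartialOrder α] : Type w :=
  {S : Set α // IsCardinalFiltered S κ₁ ∧ HasCardinalLT S κ₂}

namespace DirectedSubset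

variable {κ₁ κ₂ : Cardinal.{w}} [Fact κ₁.IsRegular]

instance (S : DirectedSubset κ₁ κ₂ α) : IsCardinalFiltered S.1 κ₁ := S.2.1

/-- The inclusion of a directed subset, as a functor. -/
abbrev incl (S : DirectedSubset κ₁ κ₂ α) : S.1 ⥤ α :=
  (Subtype.mono_coe (· ∈ S.1)).functor

lemma isCardinalFiltered [Fact κ₂.IsRegular]
    (h : ∀ A : Set α, HasCardinalLT A κ₂ →
      ∃ B : Set α, A ⊆ B ∧ IsCardinalFiltered B κ₁ ∧ HasCardinalLT B κ₂) :
    IsCardinalFiltered (DirectedSubset κ₁ κ₂ α) κ₂ :=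
  isCardinalFiltered_preorder _ _ fun K S hK ↦ by
    obtain ⟨B, hB, hB'⟩ := h (⋃ k, (S k).1) (hasCardinalLT_iUnion _
      (by rwa [hasCardinalLT_iff_cardinal_mk_lt]) fun k ↦ (S k).2.2)
    exact ⟨⟨B, hB'⟩, fun k ↦ (Set.subset_iUnion (fun k ↦ (S k).1) k).trans hB⟩

variable [HasCardinalFilteredColimits C κ₁]

instance (S : DirectedSubset κ₁ κ₂ α) : HasColimitsOfShape S.1 C :=
  HasCardinalFilteredColimits.hasColimitsOfShape (κ := κ₁) C S.1

/-- The colimit of a diagram over a directed subset. -/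
noncomputable def subcolimit (S : DirectedSubset κ₁ κ₂ α) (D : α ⥤ C) : C :=
  colimit (S.incl ⋙ D)

/-- The coprojections to the colimit over a directed subset. -/
noncomputable def toSubcolimit (S : DirectedSubset κ₁ κ₂ α) (D : α ⥤ C) (a : α) (ha : a ∈ S.1) :
    D.obj a ⟶ S.subcolimit D :=
  colimit.ι (S.incl ⋙ D) ⟨a, ha⟩

lemma map_toSubcolimit (S : DirectedSubset κ₁ κ₂ α) (D : α ⥤ C) {a b : α} (f : a ⟶ b)
    (ha : a ∈ S.1) (hb : b ∈ S.1) :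
    D.map f ≫ S.toSubcolimit D b hb = S.toSubcolimit D a ha :=
  colimit.w (S.incl ⋙ D)
    (homOfLE (show (⟨a, ha⟩ : S.1) ≤ ⟨b, hb⟩ from leOfHom f))

lemma subcolimit_hom_ext {S : DirectedSubset κ₁ κ₂ α} {D : α ⥤ C} {Z : C}
    {f g : S.subcolimit D ⟶ Z}
    (h : ∀ (a : α) (ha : a ∈ S.1), S.toSubcolimit D a ha ≫ f = S.toSubcolimit D a ha ≫ g) :
    f = g :=
  colimit.hom_ext fun a ↦ h a.1 a.2

lemma exists_subcolimit_desc (S : DirectedSubset κ₁ κ₂ α) (D : α ⥤ C) {Z : C}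
    (φ : ∀ a ∈ S.1, D.obj a ⟶ Z)
    (hφ : ∀ {a b : α} (f : a ⟶ b) (ha : a ∈ S.1) (hb : b ∈ S.1), D.map f ≫ φ b hb = φ a ha) :
    ∃ f : S.subcolimit D ⟶ Z, ∀ (a : α) (ha : a ∈ S.1), S.toSubcolimit D a ha ≫ f = φ a ha :=
  ⟨colimit.desc (S.incl ⋙ D)
    { pt := Z
      ι.app a := φ a.1 a.2
      ι.naturality a b f := (hφ (homOfLE (leOfHom f)) a.2 b.2).trans (Category.comp_id _).symm },
    fun a ha ↦ colimit.ι_desc _ (⟨a, ha⟩ : S.1)⟩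

lemma exists_subcolimit_map (D : α ⥤ C) {S T : DirectedSubset κ₁ κ₂ α} (h : S ≤ T) :
    ∃ f : S.subcolimit D ⟶ T.subcolimit D, ∀ (a : α) (ha : a ∈ S.1),
      S.toSubcolimit D a ha ≫ f = T.toSubcolimit D a (h ha) :=
  S.exists_subcolimit_desc D (fun a ha ↦ T.toSubcolimit D a (h ha))
    fun f _ _ ↦ T.map_toSubcolimit D f _ _

/-- The transition maps between the colimits over directed subsets. -/
noncomputable def subcolimitMap (D : α ⥤ C) {S T : DirectedSubset κ₁ κ₂ α} (h : S ≤ T) :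
    S.subcolimit D ⟶ T.subcolimit D :=
  (exists_subcolimit_map D h).choose

lemma toSubcolimit_map (D : α ⥤ C) {S T : DirectedSubset κ₁ κ₂ α} (h : S ≤ T) (a : α)
    (ha : a ∈ S.1) :
    S.toSubcolimit D a ha ≫ subcolimitMap D h = T.toSubcolimit D a (h ha) :=
  (exists_subcolimit_map D h).choose_spec a ha

variable (κ₁ κ₂) in
/-- The functor sending a directed subset `S` to the colimit over `S` of a given diagram. -/
noncomputable abbrev subcolimitFunctor (D : α ⥤ C) : DirectedSubset κ₁ κ₂ α ⥤ C where
  obj S := S.subcolimit D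
  map f := subcolimitMap D (leOfHom f)
  map_id S := subcolimit_hom_ext fun a ha ↦ by rw [toSubcolimit_map, Category.comp_id]
  map_comp f g := subcolimit_hom_ext fun a ha ↦ by
    rw [toSubcolimit_map, ← Category.assoc, toSubcolimit_map, toSubcolimit_map]

lemma exists_subcolimit_cocone {D : α ⥤ C} (c : Cocone D) (S : DirectedSubset κ₁ κ₂ α) :
    ∃ f : S.subcolimit D ⟶ c.pt, ∀ (a : α) (ha : a ∈ S.1),
      S.toSubcolimit D a ha ≫ f = c.ι.app a :=
  S.exists_subcolimit_desc D (fun a _ ↦ c.ι.app a) fun f _ _ ↦ c.w f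

/-- The map from the colimit over a directed subset to the point of a cocone over the whole
diagram. -/
noncomputable def subcolimitDesc {D : α ⥤ C} (c : Cocone D) (S : DirectedSubset κ₁ κ₂ α) :
    S.subcolimit D ⟶ c.pt :=
  (exists_subcolimit_cocone c S).choose

lemma toSubcolimit_desc {D : α ⥤ C} (c : Cocone D) (S : DirectedSubset κ₁ κ₂ α) (a : α)
    (ha : a ∈ S.1) : S.toSubcolimit D a ha ≫ S.subcolimitDesc c = c.ι.app a :=
  (exists_subcolimit_cocone c S).choose_spec a ha

variable (κ₁ κ₂) in
/-- The cocone over `subcolimitFunctor` induced by a cocone over the whole diagram. -/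
noncomputable abbrev subcolimitCocone {D : α ⥤ C} (c : Cocone D) :
    Cocone (subcolimitFunctor κ₁ κ₂ D) where
  pt := c.pt
  ι.app S := S.subcolimitDesc c
  ι.naturality S T f := (subcolimit_hom_ext fun a ha ↦ by
    rw [← Category.assoc, toSubcolimit_map, toSubcolimit_desc, toSubcolimit_desc] :
      subcolimitMap D (leOfHom f) ≫ T.subcolimitDesc c = S.subcolimitDesc c).trans
    (Category.comp_id _).symm

/-- A colimit over a partially ordered type is the colimit of the colimits over its directed
subsets of cardinality `< κ₂`. -/
lemma nonempty_isColimit_subcolimitCocone [Fact κ₂.IsRegular]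
    (h : ∀ A : Set α, HasCardinalLT A κ₂ →
      ∃ B : Set α, A ⊆ B ∧ IsCardinalFiltered B κ₁ ∧ HasCardinalLT B κ₂)
    {D : α ⥤ C} {c : Cocone D} (hc : IsColimit c) :
    Nonempty (IsColimit (subcolimitCocone κ₁ κ₂ c)) := by
  have hκ₂ : ℵ₀ ≤ κ₂ := IsRegular.aleph0_le Fact.out
  have hex (A : Set α) (hA : A.Finite) : ∃ S : DirectedSubset κ₁ κ₂ α, A ⊆ S.1 := by
    have := hA.to_subtype
    obtain ⟨B, hB, hB'⟩ := h A (hasCardinalLT_of_finite _ _ hκ₂)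
    exact ⟨⟨B, hB'⟩, hB⟩
  have hmem (a : α) : ∃ S : DirectedSubset κ₁ κ₂ α, a ∈ S.1 := by
    obtain ⟨S, hS⟩ := hex {a} (Set.finite_singleton a)
    exact ⟨S, hS rfl⟩
  choose S hS using hmem
  let leg (s : Cocone (subcolimitFunctor κ₁ κ₂ D)) (T : DirectedSubset κ₁ κ₂ α) :
    T.subcolimit D ⟶ s.pt := s.ι.app T
  have hw (s : Cocone (subcolimitFunctor κ₁ κ₂ D)) {T T' : DirectedSubset κ₁ κ₂ α} (f : T ≤ T')
      (a : α) (ha : a ∈ T.1) : T.toSubcolimit D a ha ≫ leg s T =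
        T'.toSubcolimit D a (f ha) ≫ leg s T' := by
    have : subcolimitMap D f ≫ leg s T' = leg s T := s.w (homOfLE f)
    rw [← this, ← Category.assoc, toSubcolimit_map]
  -- Two directed subsets containing `a` lie in a third, so the leg at `a` does not depend on the
  -- choice of `S a`.
  have hind (s : Cocone (subcolimitFunctor κ₁ κ₂ D)) (a : α) (T T' : DirectedSubset κ₁ κ₂ α)
      (ha : a ∈ T.1) (ha' : a ∈ T'.1) :
      T.toSubcolimit D a ha ≫ leg s T = T'.toSubcolimit D a ha' ≫ leg s T' := by
    obtain ⟨B, hB, hB'⟩ := h (T.1 ∪ T'.1) (hasCardinalLT_union hκ₂ T.2.2 T'.2.2)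
    have f : T ≤ ⟨B, hB'⟩ := Set.subset_union_left.trans hB
    have f' : T' ≤ ⟨B, hB'⟩ := Set.subset_union_right.trans hB
    rw [hw s f, hw s f']
  let desc (s : Cocone (subcolimitFunctor κ₁ κ₂ D)) : Cocone D :=
    { pt := s.pt
      ι.app a := (S a).toSubcolimit D a (hS a) ≫ leg s (S a)
      ι.naturality a b f := by
        obtain ⟨T, hT⟩ := hex {a, b} (Set.toFinite _)
        have ha : a ∈ T.1 := hT (by simp)
        have hb : b ∈ T.1 := hT (by simp)
        refine Eq.trans ?_ (Category.comp_id _).symm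
        rw [hind s a (S a) T (hS a) ha, hind s b (S b) T (hS b) hb, ← Category.assoc,
          map_toSubcolimit] }
  exact ⟨{
    desc s := hc.desc (desc s)
    fac s T := subcolimit_hom_ext fun a ha ↦ by
      refine ((Category.assoc _ _ _).symm.trans
        (congr_arg (· ≫ hc.desc (desc s)) (toSubcolimit_desc c T a ha))).trans ?_
      rw [hc.fac]
      exact hind s a _ _ _ _
    uniq s m hm := by
      refine hc.hom_ext fun a ↦ ?_
      rw [hc.fac]
      refine ((Category.assoc _ _ _).symm.trans
        (congr_arg (· ≫ m) (toSubcolimit_desc c (S a) a (hS a)))).symm.trans ?_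
      exact congr_arg (_ ≫ ·) (hm (S a)) }⟩

end DirectedSubset

end DirectedSubsets

/-! ### Size of presentable objects. -/

section Size

variable {C : Type u} [Category.{v} C]

/-- If `χ ^ κ ≤ χ`, a `χ⁺`-presentable object of a category with `κ`-filtered colimits receives
at most `χ` morphisms from the objects of a `κ`-filtered generator `P`, provided that this holds
for the objects of `P`. -/
lemma CategoryTheory.ObjectProperty.IsCardinalFilteredGenerator.hasCardinalLT_homsFrom
    {κ : Cardinal.{w}} [Fact κ.IsRegular] [HasCardinalFilteredColimits C κ]
    {P : ObjectProperty C} (h : P.IsCardinalFilteredGenerator κ)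
    {χ : Cardinal.{w}} [Fact (Order.succ χ).IsRegular] (hκχ : κ ≤ χ) (hχ : χ ^ κ ≤ χ)
    (hP : ∀ B : Subtype P, HasCardinalLT (HomsFrom P B.1) (Order.succ χ))
    (X : C) [IsCardinalPresentable X (Order.succ χ)] :
    HasCardinalLT (HomsFrom P X) (Order.succ χ) := by
  have h₀ : ℵ₀ ≤ χ := (IsRegular.aleph0_le (Fact.out : κ.IsRegular)).trans hκχ
  obtain ⟨J, _, _, ⟨q⟩⟩ := h.exists_colimitsOfShape X
  obtain ⟨α, _, _, F, _⟩ := IsCardinalFiltered.exists_cardinal_directed J κ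
  let p := q.reindex F
  have hα (A : Set α) (hA : HasCardinalLT A (Order.succ χ)) :
      ∃ B : Set α, A ⊆ B ∧ IsCardinalFiltered B κ ∧ HasCardinalLT B (Order.succ χ) :=
    SharplyLT.exists_isCardinalFiltered_set_of_exists_cofinal
      (hκχ.trans_lt (Order.lt_succ χ))
      (fun Y hY ↦ ⟨Set.univ,
        (hasCardinalLT_setCardinalLT h₀ hχ Y hY).of_injective _ Subtype.val_injective,
        .univ⟩) A hA
  have := DirectedSubset.isCardinalFiltered hα
  obtain ⟨hc⟩ := DirectedSubset.nonempty_isColimit_subcolimitCocone hα p.isColimit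
  -- Presentability makes `X` a retract of a colimit over at most `χ` objects of `P`; each morphism
  -- to `X` then comes from one of these objects.
  obtain ⟨S, r, hr⟩ : ∃ (S : DirectedSubset κ (Order.succ χ) α) (r : X ⟶ S.subcolimit p.diag),
      r ≫ S.subcolimitDesc p.cocone = 𝟙 X :=
    IsCardinalPresentable.exists_hom_of_isColimit (Order.succ χ) hc (𝟙 X)
  have hS := (hasCardinalLT_sigma (fun s : S.1 ↦ HomsFrom P (p.diag.obj s)) (Order.succ χ) S.2.2
    (fun s ↦ hP ⟨_, p.prop_diag_obj s⟩))
  refine hS.of_surjective (fun x ↦ ⟨x.2.1, x.2.2 ≫ p.ι.app x.1⟩) (fun ⟨A, f⟩ ↦ ?_)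
  have : IsCardinalPresentable A.1 κ := h.le_isCardinalPresentable _ A.2
  obtain ⟨s, g, hg⟩ : ∃ (s : S.1) (g : A.1 ⟶ p.diag.obj s.1),
      g ≫ S.toSubcolimit p.diag s.1 s.2 = f ≫ r :=
    IsCardinalPresentable.exists_hom_of_isColimit κ (colimit.isColimit (S.incl ⋙ p.diag)) (f ≫ r)
  refine ⟨⟨s, A, g⟩, ?_⟩
  have : g ≫ p.ι.app s.1 = f :=
    calc g ≫ p.ι.app s.1
      _ = g ≫ S.toSubcolimit p.diag s.1 s.2 ≫ S.subcolimitDesc p.cocone :=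
        congr_arg (g ≫ ·) (S.toSubcolimit_desc p.cocone s.1 s.2).symm
      _ = f ≫ r ≫ S.subcolimitDesc p.cocone := by rw [reassoc_of% hg]
      _ = f := (congr_arg (f ≫ ·) hr).trans (Category.comp_id f)
  exact Sigma.ext rfl (heq_of_eq this)

end Size

/-! ### Chains of non-isomorphisms. -/

section Chain

variable {C : Type u} [Category.{v} C]

/-- In a partially ordered type where families of size `< κ` are bounded, given an inflationary
function `e`, there is a monotone sequence `f` of length `κ` such that `e (f b) ≤ f a` for
`b < a`. -/
lemma exists_monotone_of_isCardinalFiltered {κ : Cardinal.{w}} [Fact κ.IsRegular]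
    {α : Type w} [PartialOrder α] [IsCardinalFiltered α κ] (e : α → α) (he : ∀ a, a ≤ e a) :
    ∃ f : κ.ord.ToType → α, Monotone f ∧ ∀ a b, b < a → e (f b) ≤ f a := by
  have hlt (a : κ.ord.ToType) : HasCardinalLT (Set.Iio a) κ := by
    rw [hasCardinalLT_iff_cardinal_mk_lt]
    simpa using mk_Iio_lt a
  let f : κ.ord.ToType → α := wellFounded_lt.fix fun a ih ↦
    IsCardinalFiltered.max (fun b : Set.Iio a ↦ e (ih b.1 b.2)) (hlt a)
  have hf (a b : κ.ord.ToType) (hab : b < a) : e (f b) ≤ f a := by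
    have : f a = IsCardinalFiltered.max (fun b : Set.Iio a ↦ e (f b.1)) (hlt a) :=
      WellFounded.fix_eq _ _ _
    rw [this]
    exact leOfHom (IsCardinalFiltered.toMax (fun b : Set.Iio a ↦ e (f b.1)) (hlt a) ⟨b, hab⟩)
  refine ⟨f, fun b a hba ↦ ?_, hf⟩
  obtain rfl | hba := hba.eq_or_lt
  · exact le_rfl
  · exact (he _).trans (hf a b hba)

/-- If all morphisms are monomorphisms, the first factor of an isomorphism is an isomorphism. -/
lemma isIso_left_of_isIso_comp (hmono : ∀ (X Y : C) (f : X ⟶ Y), Mono f)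
    {X Y Z : C} (f : X ⟶ Y) (g : Y ⟶ Z) [IsIso (f ≫ g)] : IsIso f := by
  have := hmono _ _ g
  have : IsSplitEpi g := ⟨⟨⟨inv (f ≫ g) ≫ f, by simp⟩⟩⟩
  have : IsIso g := isIso_of_mono_of_isSplitEpi g
  exact IsIso.of_isIso_comp_right f g

/-- Let `μ` be a regular cardinal. In a category with `μ`-filtered colimits where all morphisms
are monomorphisms and every object is a `μ⁺`-filtered colimit of `μ⁺`-presentable objects, either
all objects are `μ⁺`-presentable, or some `μ⁺`-presentable object is not `μ`-presentable. -/
lemma exists_isCardinalPresentable_succ_not_isCardinalPresentable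
    (hmono : ∀ (X Y : C) (f : X ⟶ Y), Mono f) [LocallySmall.{w} C]
    {μ : Cardinal.{w}} [hμ : Fact μ.IsRegular] [Fact (Order.succ μ).IsRegular]
    [HasCardinalFilteredColimits C μ] {P : ObjectProperty C}
    (hP : P.IsCardinalFilteredGenerator (Order.succ μ))
    (N : C) (hN : ¬ IsCardinalPresentable N (Order.succ μ)) :
    ∃ M : C, IsCardinalPresentable M (Order.succ μ) ∧ ¬ IsCardinalPresentable M μ := by
  by_contra! H
  obtain ⟨J, _, _, ⟨q⟩⟩ := hP.exists_colimitsOfShape N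
  obtain ⟨α, _, _, F, _⟩ := IsCardinalFiltered.exists_cardinal_directed J (Order.succ μ)
  have := isFiltered_of_isCardinalFiltered α (Order.succ μ)
  have : IsCardinalFiltered α μ := .of_le α (Order.le_succ μ)
  let p := q.reindex F
  have hpres (a : α) : IsCardinalPresentable (p.diag.obj a) (Order.succ μ) :=
    hP.le_isCardinalPresentable _ (p.prop_diag_obj a)
  -- Otherwise the diagram is constant from `a` on, and `N` is isomorphic to its value at `a`.
  have hnext (a : α) : ∃ b : α, ∃ hab : a ≤ b, ¬ IsIso (p.diag.map (homOfLE hab)) := by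
    by_contra! hiso
    have hconst : p.diag.IsEventuallyConstantFrom a := fun b f ↦ hiso b (leOfHom f)
    have := hconst.isIso_ι_of_isColimit p.isColimit
    exact hN (isCardinalPresentable_of_iso (asIso (p.cocone.ι.app a)) _)
  choose e he he' using hnext
  obtain ⟨f, hf, hf'⟩ := exists_monotone_of_isCardinalFiltered (κ := μ) e he
  have := HasCardinalFilteredColimits.hasColimitsOfShape (κ := μ) C μ.ord.ToType
  let D : μ.ord.ToType ⥤ C := hf.functor ⋙ p.diag
  have (a : μ.ord.ToType) : IsCardinalPresentable (D.obj a) (Order.succ μ) := hpres (f a)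
  have hcard : HasCardinalLT μ.ord.ToType (Order.succ μ) := by
    simp [hasCardinalLT_iff_cardinal_mk_lt]
  have harr : HasCardinalLT (Arrow μ.ord.ToType) (Order.succ μ) :=
    (hasCardinalLT_prod (IsRegular.aleph0_le Fact.out) hcard hcard).of_injective
      (fun a ↦ (a.left, a.right)) (fun a b hab ↦ by
        obtain ⟨_, _, _⟩ := a
        obtain ⟨_, _, _⟩ := b
        cases hab
        exact congr_arg Arrow.mk (Subsingleton.elim (α := (_ : μ.ord.ToType) ⟶ _) _ _))
  have hC : IsCardinalPresentable (colimit D) (Order.succ μ) :=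
    isCardinalPresentable_of_isColimit _ (colimit.isColimit D) _ harr
  have := H _ hC
  obtain ⟨a, r, hr⟩ := IsCardinalPresentable.exists_hom_of_isColimit μ
    (colimit.isColimit D) (𝟙 (colimit D))
  have : NoMaxOrder μ.ord.ToType := Cardinal.noMaxOrder hμ.out.aleph0_le
  obtain ⟨b, hab⟩ := exists_gt a
  have := hmono _ _ (colimit.ι D a)
  have : IsSplitEpi (colimit.ι D a) := ⟨⟨⟨r, hr⟩⟩⟩
  have h₁ : IsIso (colimit.ι D a) := isIso_of_mono_of_isSplitEpi _
  -- Invertibility passes to first factors: from the coprojection at `a` to `D a ⟶ D b`, then to the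
  -- step from `f a` to `e (f a)`.
  rw [← colimit.w D (homOfLE hab.le)] at h₁
  have h₂ : IsIso (D.map (homOfLE hab.le)) := isIso_left_of_isIso_comp hmono _ (colimit.ι D b)
  have : IsIso (p.diag.map (homOfLE (he (f a))) ≫ p.diag.map (homOfLE (hf' b a hab))) := by
    rw [← Functor.map_comp]
    exact h₂
  exact he' (f a) (isIso_left_of_isIso_comp hmono _ (p.diag.map (homOfLE (hf' b a hab))))

end Chain

/-- A large category with a small set of `θ`-presentable objects up to isomorphism has an object
which is not `θ`-presentable. -/
lemma IsLargeCategory.exists_not_isCardinalPresentable {K : Type u} [Category.{v} K]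
    (hK : IsLargeCategory.{w} K) (θ : Cardinal.{w}) [Fact θ.IsRegular]
    [ObjectProperty.EssentiallySmall.{w} (isCardinalPresentable K θ)] :
    ∃ N : K, ¬ IsCardinalPresentable N θ := by
  by_contra! H
  obtain ⟨Q, _, -, hQ⟩ := ObjectProperty.EssentiallySmall.exists_small_le.{w}
    (isCardinalPresentable K θ)
  refine hK (small_of_surjective (α := Subtype Q)
    (f := fun A ↦ Quotient.mk (isIsomorphicSetoid K) A.1) fun x ↦ ?_)
  induction x using Quotient.inductionOn with
  | h N =>
    obtain ⟨A, hA, ⟨i⟩⟩ := hQ N (H N)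
    exact ⟨⟨A, hA⟩, Quotient.sound ⟨i.symm⟩⟩

/-! ### Successors of regular and of singular cardinals. -/

section Main

variable {K : Type u} [Category.{v} K]

lemma hasPresentabilityRank_succ {M : K} {μ : Cardinal.{w}} [hμ : Fact (Order.succ μ).IsRegular]
    (hM : IsCardinalPresentable M (Order.succ μ))
    (h : ∀ (κ : Cardinal.{w}) (_ : Fact κ.IsRegular), κ ≤ μ → ¬ IsCardinalPresentable M κ) :
    HasPresentabilityRank M (Order.succ μ) :=
  ⟨⟨hμ, hM⟩, fun κ ⟨_, hκ⟩ ↦ by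
    by_contra! hlt
    exact h κ _ (Order.lt_succ_iff.1 hlt) hκ⟩

/-- The case of the successor of a regular cardinal, which does not depend on `SCH`. -/
lemma exists_hasPresentabilityRank_succ_of_isRegular (hlarge : IsLargeCategory.{w} K)
    (hmono : ∀ (X Y : K) (f : X ⟶ Y), Mono f) {μ : Cardinal.{w}} [Fact μ.IsRegular]
    [Fact (Order.succ μ).IsRegular] [HasCardinalFilteredColimits K μ]
    [IsCardinalAccessibleCategory K (Order.succ μ)] :
    ∃ M : K, HasPresentabilityRank M (Order.succ μ) := by
  obtain ⟨N, hN⟩ := hlarge.exists_not_isCardinalPresentable (Order.succ μ)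
  obtain ⟨M, hM, hM'⟩ := exists_isCardinalPresentable_succ_not_isCardinalPresentable hmono
    (isCardinalFilteredGenerator_isCardinalPresentable K (Order.succ μ)) N hN
  exact ⟨M, hasPresentabilityRank_succ hM fun κ _ hκμ h ↦
    hM' (isCardinalPresentable_of_le M hκμ)⟩

/-- The case of the successor of a singular cardinal `μ` such that for any `c < μ` there is
`χ` with `c ≤ χ`, `χ⁺ ≤ μ` and `χ ^ κ ≤ χ`. -/
lemma exists_hasPresentabilityRank_succ_of_isSingular (hlarge : IsLargeCategory.{w} K)
    {κ : Cardinal.{w}} [Fact κ.IsRegular] [IsCardinalAccessibleCategory K κ]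
    {P : ObjectProperty K} (hP : P.IsCardinalFilteredGenerator κ)
    {b : Cardinal.{w}} (hκb : κ ≤ b)
    (hb : ∀ A B : Subtype P, HasCardinalLT (A.1 ⟶ B.1) b)
    (hb' : ∀ B : Subtype P, HasCardinalLT (HomsFrom P B.1) b)
    {μ : Cardinal.{w}} (hbμ : b < μ) (hμ : μ.IsSingular)
    (hpow : ∀ c < μ, ∃ χ, c ≤ χ ∧ Order.succ χ ≤ μ ∧ χ ^ κ ≤ χ)
    [Fact (Order.succ μ).IsRegular]
    [IsCardinalAccessibleCategory K (Order.succ μ)] :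
    ∃ M : K, HasPresentabilityRank M (Order.succ μ) := by
  have hκμ : κ ≤ Order.succ μ := (hκb.trans hbμ.le).trans (Order.le_succ μ)
  obtain ⟨N, hN⟩ := hlarge.exists_not_isCardinalPresentable (Order.succ μ)
  have hN' : ¬ HasCardinalLT (HomsFrom P N) (Order.succ μ) := fun h ↦
    hN (hP.isCardinalPresentable_of_hasCardinalLT hκμ
      (fun A B ↦ (hb A B).of_le (hbμ.le.trans (Order.le_succ μ))) h)
  obtain ⟨J, _, _, ⟨p⟩⟩ := (isCardinalFilteredGenerator_isCardinalPresentable K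
    (Order.succ μ)).exists_colimitsOfShape N
  obtain ⟨j, hj⟩ := hP.exists_not_hasCardinalLT hκμ p.isColimit hN'
  refine ⟨p.diag.obj j, hasPresentabilityRank_succ (p.prop_diag_obj j) fun l hl hlμ hM ↦ hj ?_⟩
  have hlμ' : l < μ := lt_of_le_of_ne hlμ fun h ↦ hμ.not_isRegular (h ▸ hl.out)
  obtain ⟨χ, hχ, hχμ, hχκ⟩ := hpow (max l b) (max_lt hlμ' hbμ)
  have hbχ : b ≤ χ := (le_max_right _ _).trans hχ
  have : Fact (Order.succ χ).IsRegular :=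
    ⟨isRegular_succ ((IsRegular.aleph0_le hl.out).trans ((le_max_left _ _).trans hχ))⟩
  have : IsCardinalPresentable (p.diag.obj j) (Order.succ χ) :=
    isCardinalPresentable_of_le _ (((le_max_left _ _).trans hχ).trans (Order.le_succ χ))
  exact (hP.hasCardinalLT_homsFrom (hκb.trans hbχ) hχκ
    (fun B ↦ (hb' B).of_le (hbχ.trans (Order.le_succ χ))) (p.diag.obj j)).of_le hχμ

/-- Under `SCH` above `b`, if `2 ^ l ≤ b` and `b ^ l ≤ b`, any singular cardinal `μ > b` is a
limit of successors of cardinals `χ` such that `χ ^ l ≤ χ`. -/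
lemma SCHAbove.exists_power_le {b l : Cardinal.{w}} (hb : SCHAbove b) (h₀ : ℵ₀ ≤ b)
    (hl : ℵ₀ ≤ l) (hbl : b ^ l ≤ b) (h2 : 2 ^ l ≤ b) {μ : Cardinal.{w}} (hbμ : b < μ)
    (hμ : μ.IsSingular) (c : Cardinal.{w}) (hc : c < μ) :
    ∃ χ, c ≤ χ ∧ Order.succ χ ≤ μ ∧ χ ^ l ≤ χ := by
  have hl₁ : 1 ≤ l := one_le_aleph0.trans hl
  -- An `l`-th power is fixed by `· ^ l` since `l * l = l`; SCH keeps it below the limit cardinal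
  -- `μ`.
  refine ⟨max c b ^ l, (le_max_left c b).trans (self_le_power _ hl₁), ?_, ?_⟩
  · refine Order.succ_le_of_lt ((hb.power_le_succ h₀ hbl h2 _ (le_max_right c b)).trans_lt ?_)
    exact hμ.isSuccLimit.succ_lt (max_lt hc hbμ)
  · rw [← power_mul, mul_eq_self hl]

end Main

theorem mainTheorem3 (hESCH : ESCH.{w}) (K : Type u) [Category.{v} K]
    (hlarge : IsLargeCategory.{w} K)
    (hmono : ∀ (X Y : K) (f : X ⟶ Y), Mono f) :
    ∃ θ₀ : Cardinal.{w}, ∀ θ : Cardinal.{w}, θ₀ ≤ θ →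
      (∃ μ : Cardinal.{w}, θ = Order.succ μ) →
      θ ∈ accessibilitySpectrum.{w} K → θ ∈ existenceSpectrum.{w} K := by
  by_cases hacc : ∃ κ : Cardinal.{w}, κ ∈ accessibilitySpectrum.{w} K
  swap
  · exact ⟨0, fun θ _ _ hθ ↦ (hacc ⟨θ, hθ⟩).elim⟩
  obtain ⟨κ, hκ, _⟩ := hacc
  obtain ⟨s, hs⟩ := hESCH
  obtain ⟨P, _, hP⟩ := HasCardinalFilteredGenerator.exists_small_generator K κ
  have : Small.{w} (Subtype P) := inferInstanceAs (ObjectProperty.Small.{w} P)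
  obtain ⟨b₀, -, hb₀⟩ := HasCardinalLT.exists_regular_cardinal_forall.{w}
    (fun B : Subtype P ↦ HomsFrom P B.1)
  -- With `m ≥ κ`, the bound `2 ^ m` satisfies `(2 ^ m) ^ κ = 2 ^ m`.
  let m := max (max κ s) b₀
  have hκm : κ ≤ m := (le_max_left _ _).trans (le_max_left _ _)
  have hκ₀ : ℵ₀ ≤ κ := hκ.out.aleph0_le
  have hm : m < 2 ^ m := cantor m
  have h₀ : ℵ₀ ≤ (2 : Cardinal.{w}) ^ m := (hκ₀.trans hκm).trans hm.le
  have hb₀' : b₀ ≤ 2 ^ m := (le_max_right _ _).trans hm.le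
  have hb' (B : Subtype P) : HasCardinalLT (HomsFrom P B.1) (2 ^ m) := (hb₀ B).of_le hb₀'
  have hSCH : SCHAbove (2 ^ m) := fun θ h h' ↦ hs θ h
    ((((le_max_right κ s).trans (le_max_left _ _)).trans hm.le).trans h')
  have hbl : ((2 : Cardinal.{w}) ^ m) ^ κ ≤ 2 ^ m := by
    rw [← power_mul, mul_eq_left (hκ₀.trans hκm) hκm hκ.out.ne_zero]
  -- The double successor makes `μ`, not only `μ⁺`, strictly larger than `2 ^ m`.
  refine ⟨Order.succ (Order.succ (2 ^ m)), ?_⟩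
  rintro _ hθ ⟨μ, rfl⟩ ⟨_, _⟩
  have hμ : 2 ^ m < μ := Order.succ_le_iff.1 (Order.succ_le_succ_iff.1 hθ)
  rcases isRegular_or_isSingular (h₀.trans hμ.le) with hreg | hsing
  · have : Fact μ.IsRegular := ⟨hreg⟩
    have : HasCardinalFilteredColimits K μ := ⟨fun J _ _ ↦ by
      have : IsCardinalFiltered J κ := .of_le J ((hκm.trans hm.le).trans hμ.le)
      exact HasCardinalFilteredColimits.hasColimitsOfShape (κ := κ) K J⟩
    exact exists_hasPresentabilityRank_succ_of_isRegular hlarge hmono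
  · exact exists_hasPresentabilityRank_succ_of_isSingular hlarge hP (hκm.trans hm.le)
      (fun A B ↦ (hb' B).of_injective (fun f ↦ (⟨A, f⟩ : HomsFrom P B.1))
        fun f g h ↦ by simpa using h) hb' hμ hsing
      (hSCH.exists_power_le h₀ hκ₀ hbl (power_le_power_left two_ne_zero hκm) hμ hsing)
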